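/- Let $d\in\mathbb N$ and let $p:\mathbb Z^d\to[0,1]$ be a probability distribution on $\mathbb Z^d$ ($\sum_z p(z)=1$). The exclusion process with transition probabilities $p(x,y)=p(y-x)$ is the Feller process on $\{0,1\}^{\mathbb Z^d}$ whose generator acts on functions $f$ of finitely many coordinates by $$\Omega f(\eta)=\sum_{x,y:\ \eta(x)=1,\ \eta(y)=0}p(y-x)\,[f(\eta_{x,y})-f(\eta)],$$ where $\eta_{x,y}$ is $\eta$ with the states at $x$ and $y$ interchanged. A probability measure $\mu$ on $\{0,1\}^{\mathbb Z^d}$ is stationary if the process started from $\mu$ has law $\mu$ at all times. For $v\in\mathbb R^d$, $\mu$ is called $v$-homogeneous if for each finite $A\subset\mathbb Z^d$ there is a continuous function $f_A:\mathbb R\to\mathbb R$ with $$\mu\{\eta:\eta\equiv 1\text{ on }x+A\}=f_A(\langle x,v\rangle)\quad\text{for all }x\in\mathbb Z^d;$$ it is called a $v$-profile measure if moreover the $f_A$ can be chosen so that $\lim_{s\to-\infty}f_A(s)=0$ and $\lim_{s\to\infty}f_A(s)=1$ for every $A\neq\emptyset$. **Theorem 5.** Let $v\in\mathbb R^d$ and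 suppose that $p(z)=p(-z)$ for all $z\in\mathbb Z^d$ with $\langle z,v\rangle\neq0$. 1. If $\mu$ is a $v$-homogeneous probability measure that is stationary for the exclusion process, then $\mu\{\eta:\eta(x)=1\}$ is constant, as a function of $x$, on the smallest subgroup of $\mathbb Z^d$ containing $\{z\in\mathbb Z^d:p(z)>0\}$. 2. If, in addition, $v\ne0$ and the random walk on $\mathbb Z^d$ with transition probabilities $p(y-x)$ is irreducible (for all $x,y\in\mathbb Z^d$ it goes from $x$ to $y$ in some number of steps with positive probability), then there is no $v$-profile measure that is stationary for the exclusion process. -/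

import Mathlib

open MeasureTheory ProbabilityTheory Filter Topology
open scoped NNReal

noncomputable section

namespace Exclusion

/-- Particle configurations on `ℤ^d`: `η x = true` means that the site `x` is occupied.
The space `{0,1}^(ℤ^d)` carries the product topology and the product `σ`-algebra. -/
abbrev Config (d : ℕ) : Type := (Fin d → ℤ) → Bool

/-- The inner product `⟨x, v⟩` of a lattice point `x ∈ ℤ^d` with a vector `v ∈ ℝ^d`. -/
def dot {d : ℕ} (x : Fin d → ℤ) (v : EuclideanSpace ℝ (Fin d)) : ℝ :=
  ∑ i, (x i : ℝ) * v i

/-- `p` is a probability distribution on `ℤ^d`, that is, `p(x, y) = p(y - x)` are the transition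
probabilities of a random walk. -/
structure IsStepDistribution {d : ℕ} (p : (Fin d → ℤ) → ℝ) : Prop where
  nonneg : ∀ z, 0 ≤ p z
  hasSum : HasSum p 1

/-- The probability that the random walk goes from `x` to `y` in exactly `n` steps. -/
def stepProb {d : ℕ} (p : (Fin d → ℤ) → ℝ) : ℕ → (Fin d → ℤ) → (Fin d → ℤ) → ℝ
  | 0, x, y => if x = y then 1 else 0
  | n + 1, x, y => ∑' z, p (z - x) * stepProb p n z y

/-- Irreducibility of the random walk. -/
def IsIrreducible {d : ℕ} (p : (Fin d → ℤ) → ℝ) : Prop :=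
  ∀ x y, ∃ n, 0 < stepProb p n x y

/-- The configuration obtained from `η` by interchanging the states at `x` and `y`. -/
def exchange {d : ℕ} (η : Config d) (x y : Fin d → ℤ) : Config d :=
  fun u => η (Equiv.swap x y u)

/-- `f` depends on finitely many coordinates only. -/
def IsCylinder {d : ℕ} (f : Config d → ℝ) : Prop :=
  ∃ A : Finset (Fin d → ℤ), DependsOn f (A : Set (Fin d → ℤ))

open Classical in
/-- The generator of the exclusion process: a particle at `x` moves to `y` at rate `p (y - x)`,
provided that `y` is vacant. For cylinder functions the series converges absolutely. -/
def generator {d : ℕ} (p : (Fin d → ℤ) → ℝ) (f : Config d → ℝ) (η : Config d) : ℝ :=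
  ∑' e : (Fin d → ℤ) × (Fin d → ℤ),
    if η e.1 = true ∧ η e.2 = false then p (e.2 - e.1) * (f (exchange η e.1 e.2) - f η) else 0

/-- `P` is the family of transition kernels of a Feller process on the space of
configurations. -/
structure IsFellerSemigroup {d : ℕ} (P : ℝ≥0 → Kernel (Config d) (Config d)) : Prop where
  markov : ∀ t, IsMarkovKernel (P t)
  zero : P 0 = Kernel.id
  add : ∀ s t, P (s + t) = P t ∘ₖ P s
  feller : ∀ t (f : Config d → ℝ), Continuous f → Continuous fun η => ∫ ζ, f ζ ∂(P t η)
  strong : ∀ f : Config d → ℝ, Continuous f →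
    TendstoUniformly (fun (t : ℝ≥0) η => ∫ ζ, f ζ ∂(P t η)) f (𝓝[>] 0)

/-- `P` is the family of transition kernels of the exclusion process with transition
probabilities `p(x, y) = p(y - x)`: the Feller process whose infinitesimal generator (a derivative
at time `0` in the uniform norm) is `generator p` on cylinder functions. The cylinder functions
being a core, this determines `P`. -/
structure IsExclusionSemigroup {d : ℕ} (p : (Fin d → ℤ) → ℝ)
    (P : ℝ≥0 → Kernel (Config d) (Config d)) : Prop extends IsFellerSemigroup P where
  generator_eq : ∀ f : Config d → ℝ, IsCylinder f →
    TendstoUniformly (fun (t : ℝ≥0) η => (t : ℝ)⁻¹ * ((∫ ζ, f ζ ∂(P t η)) - f η))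
      (generator p f) (𝓝[>] 0)

/-- The measure `μ` is stationary for the exclusion process: started from `μ`, the process has
law `μ` at every time. -/
def IsStationary {d : ℕ} (p : (Fin d → ℤ) → ℝ) (μ : Measure (Config d)) : Prop :=
  ∃ P : ℝ≥0 → Kernel (Config d) (Config d),
    IsExclusionSemigroup p P ∧ ∀ t, (P t).Invariant μ

/-- The probability `μ{η : η ≡ 1 on x + A}`. -/
def occProb {d : ℕ} (μ : Measure (Config d)) (A : Finset (Fin d → ℤ)) (x : Fin d → ℤ) : ℝ :=
  μ.real {η | ∀ a ∈ A, η (x + a) = true}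

/-- `μ` is `v`-homogeneous: each probability `μ{η : η ≡ 1 on x + A}` is a continuous function of
`⟨x, v⟩`. -/
def IsHomogeneous {d : ℕ} (v : EuclideanSpace ℝ (Fin d)) (μ : Measure (Config d)) : Prop :=
  ∀ A : Finset (Fin d → ℤ), ∃ f : ℝ → ℝ, Continuous f ∧ ∀ x, occProb μ A x = f (dot x v)

/-- `μ` is a `v`-profile measure: it is `v`-homogeneous, and for nonempty `A` the continuous
function representing `μ{η : η ≡ 1 on x + A}` tends to `0` at `-∞` and to `1` at `+∞`. -/
def IsProfile {d : ℕ} (v : EuclideanSpace ℝ (Fin d)) (μ : Measure (Config d)) : Prop :=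
  ∀ A : Finset (Fin d → ℤ), ∃ f : ℝ → ℝ, Continuous f ∧ (∀ x, occProb μ A x = f (dot x v)) ∧
    (A.Nonempty → Tendsto f atBot (𝓝 0) ∧ Tendsto f atTop (𝓝 1))

end Exclusion

end

/-! Let `ρ x = occProb μ {0} x` be the density. Stationarity makes the mean flow into `x` equal the
mean flow out (`IsStationary.hasSum_flow`), each flow being a density minus a two-point correlation.
Steps orthogonal to `v` drop out: by homogeneity their inflow and outflow agree. The other steps
have symmetric rates, so `z` may be replaced by `-z` in the inflow; the correlations of `{x, x + z}`
then cancel. What remains says that `ρ` is a bounded harmonic function of the walk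
(`IsStationary.hasSum_harmonic`), so Choquet–Deny (`harmonic_add_eq`) makes it invariant under the
group generated by the steps. For an irreducible walk this is all of `ℤ^d`, and a constant density
cannot tend to both 0 and 1. -/

namespace Exclusion

/-! ### Bounded harmonic functions on abelian groups -/

section ChoquetDeny

variable {G : Type*} [AddCommGroup G]

/-- The increments of a bounded harmonic function along a step of positive probability are
nonpositive. -/
lemma harmonic_add_le {p u : G → ℝ} {C : ℝ} (hp : ∀ z, 0 ≤ p z) (hp1 : HasSum p 1)
    (hu : ∀ x, |u x| ≤ C) (hharm : ∀ x, HasSum (fun z => p z * (u (x + z) - u x)) 0)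
    {z : G} (hz : 0 < p z) (x : G) : u (x + z) ≤ u x := by
  set g : G → ℝ := fun x => u (x + z) - u x with hg
  have hgC : ∀ y, g y ≤ 2 * C := fun y => by
    have h1 := abs_le.1 (hu (y + z)); have h2 := abs_le.1 (hu y)
    simp only [hg]; linarith
  have hbdd : BddAbove (Set.range g) := ⟨2 * C, by rintro _ ⟨y, rfl⟩; exact hgC y⟩
  set M := ⨆ y, g y with hM
  have hgM : ∀ y, g y ≤ M := fun y => le_ciSup hbdd y
  by_contra! hlt
  have hMpos : 0 < M := lt_of_lt_of_le (sub_pos.2 hlt) (hgM x)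
  -- By commutativity the increment `g` is harmonic too, so `M - g` is nonnegative and harmonic: its
  -- value at `y` dominates each single term of the average.
  have hstep : ∀ y, p z * (M - g (y + z)) ≤ M - g y := fun y => by
    have h : HasSum (fun w => p w * (M - g (y + w))) (M - g y) := by
      have := (hp1.mul_right (M - g y)).sub ((hharm (y + z)).sub (hharm y))
      simp only [one_mul, sub_zero] at this
      refine this.congr_fun ?_
      intro w
      simp only [hg, add_right_comm y w z]
      ring
    exact le_hasSum h z fun w _ => mul_nonneg (hp w) (sub_nonneg.2 (hgM _))
  have hiter : ∀ (k : ℕ) (y : G), p z ^ k * (M - g (y + k • z)) ≤ M - g y := by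
    intro k
    induction k with
    | zero => simp
    | succ k ih =>
      intro y
      calc p z ^ (k + 1) * (M - g (y + (k + 1) • z))
          = p z ^ k * (p z * (M - g (y + k • z + z))) := by
            rw [succ_nsmul, add_assoc]; ring
        _ ≤ p z ^ k * (M - g (y + k • z)) := by gcongr; exact hstep _
        _ ≤ _ := ih y
  have hz1 : p z ≤ 1 := le_hasSum hp1 z fun w _ => hp w
  -- `K` increments of at least `M / 2` would exceed the largest possible oscillation `2 * C` of
  -- `u`.
  obtain ⟨K, hK⟩ := exists_nat_gt (2 * C / (M / 2))
  rw [div_lt_iff₀ (by positivity)] at hK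
  have : Nonempty G := ⟨0⟩
  -- Each step along `z` inflates the defect `M - g` by at most `1 / p z`; this tolerance keeps it
  -- below `M / 2` for `K` steps.
  obtain ⟨y, hy⟩ := exists_lt_of_lt_ciSup
    (show M - p z ^ K * (M / 2) < ⨆ y, g y from sub_lt_self _ (by positivity))
  have hlow : ∀ k ≤ K, M / 2 ≤ g (y + k • z) := fun k hk => by
    have h1 : p z ^ K ≤ p z ^ k := pow_le_pow_of_le_one hz.le hz1 hk
    have h2 : p z ^ k * (M - g (y + k • z)) ≤ p z ^ k * (M / 2) :=
      (hiter k y).trans (by nlinarith)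
    linarith [le_of_mul_le_mul_left h2 (by positivity)]
  have hsum : ∀ k ≤ K, k * (M / 2) ≤ u (y + k • z) - u y := by
    intro k
    induction k with
    | zero => simp
    | succ k ih =>
      intro hk
      have h1 := ih (by omega)
      have h2 := hlow k (by omega)
      simp only [hg, add_assoc, ← succ_nsmul] at h2
      push_cast
      linarith
  have h1 := abs_le.1 (hu (y + K • z))
  have h2 := abs_le.1 (hu y)
  linarith [hsum K le_rfl]

/-- The Choquet–Deny theorem on a discrete abelian group: a bounded harmonic function of a random
walk is invariant under the subgroup generated by the steps. -/
theorem harmonic_add_eq {p u : G → ℝ} {C : ℝ} (hp : ∀ z, 0 ≤ p z) (hp1 : HasSum p 1)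
    (hu : ∀ x, |u x| ≤ C) (hharm : ∀ x, HasSum (fun z => p z * (u (x + z) - u x)) 0)
    {g : G} (hg : g ∈ AddSubgroup.closure {z | 0 < p z}) : ∀ x, u (x + g) = u x := by
  induction hg using AddSubgroup.closure_induction with
  | mem z hz =>
    intro x
    refine le_antisymm (harmonic_add_le hp hp1 hu hharm hz x) (neg_le_neg_iff.1 ?_)
    refine harmonic_add_le (u := fun x => - u x) (C := C) hp hp1 (by simpa using hu) ?_ hz x
    intro y
    have := (hharm y).neg
    rw [neg_zero] at this
    exact this.congr_fun fun w => by ring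
  | zero => simp
  | add a b _ _ ha hb => intro x; rw [← add_assoc, hb, ha]
  | neg a _ ha => intro x; rw [← ha (x + -a), neg_add_cancel_right]

end ChoquetDeny

/-! ### Occupation numbers and the generator -/

variable {d : ℕ}

/-- The number of particles at the site `x`. -/
def occ (x : Fin d → ℤ) (η : Config d) : ℝ := if η x = true then 1 else 0

lemma continuous_occ (x : Fin d → ℤ) : Continuous (occ x) :=
  (continuous_of_discreteTopology (f := fun b : Bool => if b = true then (1 : ℝ) else 0)).comp
    (continuous_apply x)

lemma isCylinder_occ (x : Fin d → ℤ) : IsCylinder (occ x) :=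
  ⟨{x}, fun η ζ h => by simp [occ, h x (by simp)]⟩

lemma occ_nonneg (x : Fin d → ℤ) (η : Config d) : 0 ≤ occ x η := by
  unfold occ; split_ifs <;> norm_num

lemma occ_le_one (x : Fin d → ℤ) (η : Config d) : occ x η ≤ 1 := by
  unfold occ; split_ifs <;> norm_num

lemma norm_occ_mul_le (x y : Fin d → ℤ) (η : Config d) : ‖occ x η * (1 - occ y η)‖ ≤ 1 := by
  have h1 := occ_nonneg x η
  have h2 := occ_le_one x η
  have h3 := occ_nonneg y η
  have h4 := occ_le_one y η
  rw [Real.norm_of_nonneg (mul_nonneg h1 (by linarith))]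
  nlinarith

lemma IsStepDistribution.summable_mul {p : (Fin d → ℤ) → ℝ} (hp : IsStepDistribution p)
    {c : (Fin d → ℤ) → ℝ} {C : ℝ} (hc : ∀ z, ‖c z‖ ≤ C) : Summable fun z => p z * c z := by
  refine Summable.of_norm_bounded (hp.hasSum.summable.mul_right C) fun z => ?_
  rw [norm_mul, Real.norm_of_nonneg (hp.nonneg z)]
  exact mul_le_mul_of_nonneg_left (hc z) (hp.nonneg z)

/-- The generator applied to the occupation number of `x`: the flow into `x` minus the flow
out of `x`. -/
lemma generator_occ {p : (Fin d → ℤ) → ℝ} (hp : IsStepDistribution p) (x : Fin d → ℤ)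
    (η : Config d) :
    generator p (occ x) η = ∑' z, p z *
      (occ (x - z) η * (1 - occ x η) - occ x η * (1 - occ (x + z) η)) := by
  classical
  -- Only jumps into or out of `x` matter. The pair `(x, x)` belongs to both families, but `F`
  -- vanishes there.
  let F : (Fin d → ℤ) × (Fin d → ℤ) → ℝ := fun e =>
    p (e.2 - e.1) * (occ e.1 η * (1 - occ e.2 η))
  have hin : HasSum (fun e => if e.2 = x then F e else 0)
      (∑' z, p z * (occ (x - z) η * (1 - occ x η))) := by
    have hinj : Function.Injective fun z : Fin d → ℤ => (x - z, x) := fun a b h => by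
      simpa using congrArg Prod.fst h
    refine (hinj.hasSum_iff ?_).1 ?_
    · rintro ⟨a, b⟩ hab
      refine if_neg fun h => hab ⟨x - a, ?_⟩
      simp only at h
      simp [h]
    · convert (hp.summable_mul fun z => norm_occ_mul_le (x - z) x η).hasSum using 2 with z
      simp [F]
  have hout : HasSum (fun e => if e.1 = x then F e else 0)
      (∑' z, p z * (occ x η * (1 - occ (x + z) η))) := by
    have hinj : Function.Injective fun z : Fin d → ℤ => (x, x + z) := fun a b h => by
      simpa using congrArg Prod.snd h
    refine (hinj.hasSum_iff ?_).1 ?_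
    · rintro ⟨a, b⟩ hab
      refine if_neg fun h => hab ⟨b - x, ?_⟩
      simp only at h
      simp [h]
    · convert (hp.summable_mul fun z => norm_occ_mul_le x (x + z) η).hasSum using 2 with z
      simp [F]
  have hsplit : (∑' z, p z * (occ (x - z) η * (1 - occ x η) - occ x η * (1 - occ (x + z) η)))
      = (∑' z, p z * (occ (x - z) η * (1 - occ x η)))
        - ∑' z, p z * (occ x η * (1 - occ (x + z) η)) := by
    rw [← (hp.summable_mul fun z => norm_occ_mul_le (x - z) x η).tsum_sub
      (hp.summable_mul fun z => norm_occ_mul_le x (x + z) η)]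
    simp only [mul_sub]
  rw [hsplit, ← (hin.sub hout).tsum_eq, generator]
  congr 1
  ext ⟨a, b⟩
  by_cases hab : η a = true ∧ η b = false
  · have hne : a ≠ b := by rintro rfl; simp_all
    by_cases ha : a = x
    · subst ha
      simp [F, hab, occ, exchange, hne.symm]
    · by_cases hb : b = x
      · subst hb
        simp [F, hab, occ, exchange, hne]
      · simp [hab, occ, exchange, ha, hb, Equiv.swap_apply_of_ne_of_ne (Ne.symm ha) (Ne.symm hb)]
  · rw [if_neg hab]
    have : F (a, b) = 0 := by
      by_cases h : η a = true
      · have : η b = true := by simpa [h] using hab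
        simp [F, occ, this]
      · simp [F, occ, h]
    simp [this]

/-- Stationary measures annihilate the generator on continuous cylinder functions. -/
lemma IsStationary.integral_generator {p : (Fin d → ℤ) → ℝ} {μ : Measure (Config d)}
    [IsProbabilityMeasure μ] (h : IsStationary p μ) {f : Config d → ℝ} (hf : IsCylinder f)
    (hfc : Continuous f) : ∫ η, generator p f η ∂μ = 0 := by
  obtain ⟨P, hP, hinv⟩ := h
  have hint : ∀ {g : Config d → ℝ}, Continuous g → Integrable g μ := fun hg =>
    hg.integrable_of_hasCompactSupport (HasCompactSupport.of_compactSpace _)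
  have hcont : ∀ t : ℝ≥0,
      Continuous fun η => (t : ℝ)⁻¹ * ((∫ ζ, f ζ ∂(P t η)) - f η) := fun t =>
    continuous_const.mul ((hP.feller t f hfc).sub hfc)
  -- A uniform limit of continuous functions.
  have hgen : Continuous (generator p f) :=
    (hP.generator_eq f hf).continuous (Frequently.of_forall hcont)
  have hzero : ∀ t : ℝ≥0, ∫ η, (t : ℝ)⁻¹ * ((∫ ζ, f ζ ∂(P t η)) - f η) ∂μ = 0 := fun t => by
    have := hP.markov t
    have hbind : ∫ η, ∫ ζ, f ζ ∂(P t η) ∂μ = ∫ η, f η ∂μ := by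
      obtain ⟨η₀⟩ : Nonempty (Config d) := inferInstance
      have hcomp := DFunLike.congr_fun (hinv t).comp_const η₀
      have hi : Integrable f ((P t ∘ₖ Kernel.const (Config d) μ) η₀) := by
        rw [hcomp]; exact hint hfc
      have := Kernel.integral_comp hi
      rw [hcomp] at this
      exact this.symm
    rw [integral_const_mul, integral_sub (hint (hP.feller t f hfc)) (hint hfc), hbind, sub_self,
      mul_zero]
  refine norm_le_zero_iff.1 (le_of_forall_pos_le_add fun ε hε => ?_)
  obtain ⟨t, ht⟩ := (Metric.tendstoUniformly_iff.1 (hP.generator_eq f hf) ε hε).exists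
  rw [← sub_zero (∫ η, generator p f η ∂μ), ← hzero t, ← integral_sub (hint hgen) (hint (hcont t))]
  rw [hzero t, zero_add]
  refine (norm_integral_le_of_norm_le_const (C := ε) (.of_forall fun η => ?_)).trans (by simp)
  rw [← dist_eq_norm]
  exact (ht η).le

/-! ### Correlations and the balance equation -/

/-- The density of particles at `x`. -/
lemma integral_occ (μ : Measure (Config d)) (x : Fin d → ℤ) :
    ∫ η, occ x η ∂μ = occProb μ {0} x := by
  have hm : MeasurableSet {η : Config d | η x = true} :=
    measurable_pi_apply (X := fun _ : Fin d → ℤ => Bool) x (measurableSet_singleton true)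
  have : occ x = Set.indicator {η : Config d | η x = true} 1 := by
    ext η; simp [occ, Set.indicator]
  rw [this, integral_indicator_one hm]
  simp [occProb]

/-- The two-point correlation. -/
lemma integral_occ_mul_occ (μ : Measure (Config d)) (x z : Fin d → ℤ) :
    ∫ η, occ x η * occ (x + z) η ∂μ = occProb μ {0, z} x := by
  have hm : MeasurableSet {η : Config d | η x = true ∧ η (x + z) = true} :=
    (measurable_pi_apply (X := fun _ : Fin d → ℤ => Bool) x (measurableSet_singleton true)).inter
      (measurable_pi_apply (X := fun _ : Fin d → ℤ => Bool) (x + z) (measurableSet_singleton true))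
  have : (fun η => occ x η * occ (x + z) η) =
      Set.indicator {η : Config d | η x = true ∧ η (x + z) = true} 1 := by
    ext η
    by_cases h1 : η x = true <;> by_cases h2 : η (x + z) = true <;>
      simp [occ, Set.indicator, h1, h2]
  rw [this, integral_indicator_one hm]
  simp [occProb]

lemma integrable_occ (μ : Measure (Config d)) [IsFiniteMeasure μ] (x : Fin d → ℤ) :
    Integrable (occ x) μ :=
  (continuous_occ x).integrable_of_hasCompactSupport (HasCompactSupport.of_compactSpace _)

lemma integrable_occ_mul_occ (μ : Measure (Config d)) [IsFiniteMeasure μ] (x y : Fin d → ℤ) :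
    Integrable (fun η => occ x η * occ y η) μ :=
  ((continuous_occ x).mul (continuous_occ y)).integrable_of_hasCompactSupport
    (HasCompactSupport.of_compactSpace _)

lemma integral_occ_mul_one_sub_occ (μ : Measure (Config d)) [IsFiniteMeasure μ]
    (x z : Fin d → ℤ) :
    ∫ η, occ x η * (1 - occ (x + z) η) ∂μ = occProb μ {0} x - occProb μ {0, z} x := by
  simp only [mul_sub, mul_one]
  rw [integral_sub (integrable_occ μ x) (integrable_occ_mul_occ μ x _), integral_occ,
    integral_occ_mul_occ]

/-- Both sides concern the same pair of sites, based at either end; this is what cancels the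
correlations. -/
lemma occProb_add_neg (μ : Measure (Config d)) (x z : Fin d → ℤ) :
    occProb μ {0, -z} (x + z) = occProb μ {0, z} x := by
  rw [← integral_occ_mul_occ, ← integral_occ_mul_occ]
  simp [mul_comm]

lemma abs_occProb_le_one (μ : Measure (Config d)) [IsProbabilityMeasure μ]
    (A : Finset (Fin d → ℤ)) (x : Fin d → ℤ) : |occProb μ A x| ≤ 1 := by
  rw [occProb, abs_of_nonneg measureReal_nonneg]
  exact measureReal_le_one

/-- The balance equation for the density of a stationary measure. -/
lemma IsStationary.hasSum_flow {p : (Fin d → ℤ) → ℝ} (hp : IsStepDistribution p)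
    {μ : Measure (Config d)} [IsProbabilityMeasure μ] (h : IsStationary p μ) (x : Fin d → ℤ) :
    HasSum (fun z => p z * ((occProb μ {0} (x - z) - occProb μ {0, z} (x - z))
      - (occProb μ {0} x - occProb μ {0, z} x))) 0 := by
  let F : (Fin d → ℤ) → Config d → ℝ := fun z η =>
    p z * (occ (x - z) η * (1 - occ x η) - occ x η * (1 - occ (x + z) η))
  have hFc : ∀ y z : Fin d → ℤ, Continuous fun η : Config d => occ y η * (1 - occ z η) :=
    fun y z => (continuous_occ y).mul (continuous_const.sub (continuous_occ z))
  have hi : ∀ y z : Fin d → ℤ, Integrable (fun η : Config d => occ y η * (1 - occ z η)) μ :=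
    fun y z => (hFc y z).integrable_of_hasCompactSupport (HasCompactSupport.of_compactSpace _)
  have hFi : ∀ z, Integrable (F z) μ := fun z => ((hi _ _).sub (hi _ _)).const_mul _
  have hFn : ∀ z η, ‖F z η‖ ≤ p z * 2 := fun z η => by
    rw [norm_mul, Real.norm_of_nonneg (hp.nonneg z)]
    refine mul_le_mul_of_nonneg_left ((norm_sub_le _ _).trans ?_) (hp.nonneg z)
    linarith [norm_occ_mul_le (x - z) x η, norm_occ_mul_le x (x + z) η]
  have hsum : Summable fun z => ∫ η, ‖F z η‖ ∂μ := by
    refine Summable.of_nonneg_of_le (fun z => integral_nonneg fun η => norm_nonneg _) (fun z => ?_)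
      (hp.hasSum.summable.mul_right 2)
    refine (integral_mono (hFi z).norm (integrable_const _) (hFn z)).trans (by simp)
  have key := hasSum_integral_of_summable_integral_norm hFi hsum
  have h0 := h.integral_generator (isCylinder_occ x) (continuous_occ x)
  simp only [generator_occ hp] at h0
  rw [h0] at key
  refine key.congr_fun fun z => ?_
  have hxz := integral_occ_mul_one_sub_occ μ (x - z) z
  rw [sub_add_cancel] at hxz
  simp only [F]
  rw [integral_const_mul, integral_sub (hi _ _) (hi _ _), hxz, integral_occ_mul_one_sub_occ]

/-! ### Homogeneity and harmonicity of the density -/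

lemma dot_add (x y : Fin d → ℤ) (v : EuclideanSpace ℝ (Fin d)) :
    dot (x + y) v = dot x v + dot y v := by
  simp [dot, add_mul, Finset.sum_add_distrib]

lemma dot_neg (x : Fin d → ℤ) (v : EuclideanSpace ℝ (Fin d)) : dot (-x) v = -dot x v := by
  simp [dot]

lemma IsHomogeneous.occProb_add {v : EuclideanSpace ℝ (Fin d)} {μ : Measure (Config d)}
    (h : IsHomogeneous v μ) (A : Finset (Fin d → ℤ)) (x : Fin d → ℤ) {z : Fin d → ℤ}
    (hz : dot z v = 0) : occProb μ A (x + z) = occProb μ A x := by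
  obtain ⟨f, -, hf⟩ := h A
  rw [hf, hf, dot_add, hz, add_zero]

/-- The density of a homogeneous stationary measure is harmonic for the random walk. -/
lemma IsStationary.hasSum_harmonic {p : (Fin d → ℤ) → ℝ} (hp : IsStepDistribution p)
    {v : EuclideanSpace ℝ (Fin d)} (hsymm : ∀ z, dot z v ≠ 0 → p z = p (-z))
    {μ : Measure (Config d)} [IsProbabilityMeasure μ] (hμ : IsHomogeneous v μ)
    (h : IsStationary p μ) (x : Fin d → ℤ) :
    HasSum (fun z => p z * (occProb μ {0} (x + z) - occProb μ {0} x)) 0 := by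
  classical
  -- Discarding the steps orthogonal to `v` leaves a symmetric weight.
  let w : (Fin d → ℤ) → ℝ := fun z => if dot z v = 0 then 0 else p z
  have hw : ∀ z, w (-z) = w z := fun z => by
    by_cases hz : dot z v = 0
    · simp [w, dot_neg, hz]
    · simp [w, dot_neg, hz, hsymm z hz]
  let a : (Fin d → ℤ) → ℝ := fun z => occProb μ {0} (x - z) - occProb μ {0, z} (x - z)
  let b : (Fin d → ℤ) → ℝ := fun z => occProb μ {0} x - occProb μ {0, z} x
  have hwb : ∀ c : (Fin d → ℤ) → ℝ, (∀ z, ‖c z‖ ≤ 2) → Summable fun z => w z * c z := by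
    intro c hc
    refine Summable.of_norm_bounded (hp.hasSum.summable.mul_right 2) fun z => ?_
    have h0 : ‖w z‖ ≤ p z := by
      by_cases hz : dot z v = 0
      · simp [w, hz, hp.nonneg z]
      · simp [w, hz, abs_of_nonneg (hp.nonneg z)]
    rw [norm_mul]
    exact mul_le_mul h0 (hc z) (norm_nonneg _) (hp.nonneg z)
  have hbound : ∀ A B y, ‖occProb μ A y - occProb μ B y‖ ≤ 2 := fun A B y => by
    refine (norm_sub_le _ _).trans ?_
    rw [Real.norm_eq_abs, Real.norm_eq_abs]
    linarith [abs_occProb_le_one μ A y, abs_occProb_le_one μ B y]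
  have hA := hwb a fun z => hbound _ _ _
  have hB := hwb b fun z => hbound _ _ _
  have hflow : HasSum (fun z => w z * a z - w z * b z) 0 := by
    refine (h.hasSum_flow hp x).congr_fun fun z => ?_
    by_cases hz : dot z v = 0
    · have hz' : dot (-z) v = 0 := by rw [dot_neg, hz, neg_zero]
      simp [w, hz, sub_eq_add_neg x z, hμ.occProb_add _ _ hz']
    · simp [w, hz, a, b, mul_sub]
  -- Only the inflow is reflected, which is why the two sums had to be separated.
  have hAneg : HasSum (fun z => w z * a (-z)) (∑' z, w z * a z) := by
    have := (Equiv.neg (Fin d → ℤ)).hasSum_iff.2 hA.hasSum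
    refine this.congr_fun fun z => ?_
    simp [hw]
  have hAB : (∑' z, w z * a z) - ∑' z, w z * b z = 0 :=
    (hA.hasSum.sub hB.hasSum).unique hflow
  have key := hAneg.sub hB.hasSum
  rw [hAB] at key
  refine key.congr_fun fun z => ?_
  by_cases hz : dot z v = 0
  · simp [w, hz, hμ.occProb_add _ _ hz]
  · simp only [w, hz, a, b, if_false, sub_neg_eq_add, occProb_add_neg]
    ring

/-- The density of a homogeneous stationary measure is invariant under the group generated by the
steps of the random walk. -/
lemma IsStationary.occProb_add_eq {p : (Fin d → ℤ) → ℝ} (hp : IsStepDistribution p)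
    {v : EuclideanSpace ℝ (Fin d)} (hsymm : ∀ z, dot z v ≠ 0 → p z = p (-z))
    {μ : Measure (Config d)} [IsProbabilityMeasure μ] (hμ : IsHomogeneous v μ)
    (h : IsStationary p μ) {g : Fin d → ℤ} (hg : g ∈ AddSubgroup.closure {z | 0 < p z})
    (x : Fin d → ℤ) : occProb μ {0} (x + g) = occProb μ {0} x :=
  harmonic_add_eq hp.nonneg hp.hasSum (abs_occProb_le_one μ {0})
    (h.hasSum_harmonic hp hsymm hμ) hg x

/-! ### Irreducibility and profile measures -/

/-- Assuming `≠ 0` rather than positivity suits the induction: a nonzero series has a nonzero term,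
and both its factors are nonzero. -/
lemma sub_mem_closure_of_stepProb_ne_zero {p : (Fin d → ℤ) → ℝ} (hp : ∀ z, 0 ≤ p z) (n : ℕ)
    {x y : Fin d → ℤ} (h : stepProb p n x y ≠ 0) :
    y - x ∈ AddSubgroup.closure {z | 0 < p z} := by
  induction n generalizing x with
  | zero =>
    have : x = y := by simpa [stepProb] using h
    simp [this]
  | succ n ih =>
    obtain ⟨z, hz⟩ : ∃ z, p (z - x) * stepProb p n z y ≠ 0 := by
      by_contra! hall
      exact h (by simp [stepProb, hall])
    have h1 : z - x ∈ AddSubgroup.closure {z | 0 < p z} :=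
      AddSubgroup.subset_closure (lt_of_le_of_ne (hp _) (left_ne_zero_of_mul hz).symm)
    simpa using add_mem (ih (right_ne_zero_of_mul hz)) h1

lemma IsIrreducible.mem_closure {p : (Fin d → ℤ) → ℝ} (hp : ∀ z, 0 ≤ p z)
    (h : IsIrreducible p) (z : Fin d → ℤ) : z ∈ AddSubgroup.closure {z | 0 < p z} := by
  obtain ⟨n, hn⟩ := h 0 z
  simpa using sub_mem_closure_of_stepProb_ne_zero hp n hn.ne'

lemma exists_dot_pos {v : EuclideanSpace ℝ (Fin d)} (hv : v ≠ 0) :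
    ∃ z : Fin d → ℤ, 0 < dot z v := by
  obtain ⟨i, hi⟩ : ∃ i, v i ≠ 0 := by
    by_contra! h
    exact hv (by ext i; simpa using h i)
  have hdot : dot (Pi.single i 1) v = v i := by
    simp [dot, Pi.single_apply]
  rcases hi.lt_or_gt with hneg | hpos
  · exact ⟨-Pi.single i 1, by rw [dot_neg, hdot]; linarith⟩
  · exact ⟨Pi.single i 1, by rwa [hdot]⟩

lemma dot_nsmul (n : ℕ) (x : Fin d → ℤ) (v : EuclideanSpace ℝ (Fin d)) :
    dot (n • x) v = n * dot x v := by
  simp [dot, Finset.mul_sum, mul_assoc]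

lemma IsProfile.isHomogeneous {v : EuclideanSpace ℝ (Fin d)} {μ : Measure (Config d)}
    (h : IsProfile v μ) : IsHomogeneous v μ := fun A =>
  let ⟨f, hf, hfx, _⟩ := h A
  ⟨f, hf, hfx⟩

/-- The density of a profile measure is not constant. -/
lemma IsProfile.exists_occProb_ne {v : EuclideanSpace ℝ (Fin d)} (hv : v ≠ 0)
    {μ : Measure (Config d)} (h : IsProfile v μ) : ∃ x, occProb μ {0} x ≠ occProb μ {0} 0 := by
  by_contra! hconst
  obtain ⟨f, -, hfx, hlim⟩ := h {0}
  obtain ⟨hbot, htop⟩ := hlim (Finset.singleton_nonempty 0)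
  obtain ⟨z, hz⟩ := exists_dot_pos hv
  have hpos : Tendsto (fun n : ℕ => dot (n • z) v) atTop atTop := by
    simp only [dot_nsmul]
    exact tendsto_natCast_atTop_atTop.atTop_mul_const hz
  have hneg : Tendsto (fun n : ℕ => dot (-(n • z)) v) atTop atBot := by
    simp only [dot_neg]
    exact tendsto_neg_atTop_atBot.comp hpos
  have h1 := htop.comp hpos
  have h0 := hbot.comp hneg
  -- Along `n • z` and `-(n • z)` the density is now a constant sequence, with limits 1 and 0.
  simp only [Function.comp_def, ← hfx, hconst] at h1 h0
  exact zero_ne_one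
    ((tendsto_nhds_unique h0 tendsto_const_nhds).trans
      (tendsto_nhds_unique h1 tendsto_const_nhds).symm)

end Exclusion

theorem theorem5 (d : ℕ) (p : (Fin d → ℤ) → ℝ) (hp : Exclusion.IsStepDistribution p)
    (v : EuclideanSpace ℝ (Fin d))
    (hsymm : ∀ z, Exclusion.dot z v ≠ 0 → p z = p (-z)) :
    (∀ μ : Measure (Exclusion.Config d), IsProbabilityMeasure μ →
      Exclusion.IsHomogeneous v μ → Exclusion.IsStationary p μ →
      ∀ x ∈ AddSubgroup.closure {z | 0 < p z}, ∀ y ∈ AddSubgroup.closure {z | 0 < p z},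
        μ.real {η | η x = true} = μ.real {η | η y = true}) ∧
    (v ≠ 0 → Exclusion.IsIrreducible p →
      ¬ ∃ μ : Measure (Exclusion.Config d), IsProbabilityMeasure μ ∧
        Exclusion.IsProfile v μ ∧ Exclusion.IsStationary p μ) := by
  refine ⟨fun μ _ hμ hst x hx y hy => ?_, ?_⟩
  · have hx0 := hst.occProb_add_eq hp hsymm hμ hx 0
    have hy0 := hst.occProb_add_eq hp hsymm hμ hy 0
    simpa [Exclusion.occProb] using hx0.trans hy0.symm
  · rintro hv hirr ⟨μ, _, hprof, hst⟩
    obtain ⟨x, hx⟩ := hprof.exists_occProb_ne hv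
    refine hx ?_
    simpa using hst.occProb_add_eq hp hsymm hprof.isHomogeneous (hirr.mem_closure hp.nonneg x) 0
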